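/- A finite poset $(X,\preceq)$ with least element $0$ is a \emph{simplicial poset} if for every $\sigma\in X$ (a \emph{simplex}) there is an integer $d\ge -1$ such that the segment $[0,\sigma]$ is isomorphic to the poset of all subsets of a $(d+1)$-element set ordered by inclusion; $d$ is the \emph{dimension} of $\sigma$ (so $0$ has dimension $-1$). A \emph{vertex} is a simplex of dimension $0$. For a set $S$ of vertices of $X$, let $X[S]$ be the sub-poset of the simplices of $X$ all of whose vertices lie in $S$, and for $\sigma\in X[S]$ let $\dot D_{X[S]}(\sigma)$ be the order complex of $\{\tau\in X[S] : \sigma\prec\tau\}$, i.e. the simplicial complex whose simplices are the totally ordered subsets of this poset. Let $\tilde H_j$ denote reduced simplicial homology with rational coefficients, where $\tilde H_{-1}$ of the empty complex (without vertices) is $\mathbb{Q}$. Let $J(X)$ be the smallest integer $\ell$ such that $\tilde H_j(\dot D_{X[S]}(\sigma))=0$ for every $j\ge \ell$, every set $S$ of vertices of $X$ and every $\sigma\in X[S]$. Let $X$ and $Y$ be simplicial posets and let $k\ge 0$ be an integer. Suppose that there exists a map $f:X\to Y$ which is monotone ($\sigma\preceq\tau$ implies $f(\sigma)\preceq f(\tau)$),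 dimension-preserving ($\dim f(\sigma)=\dim\sigma$ for all $\sigma\in X$), and whose restriction to the simplices of $X$ of dimension at least $k$ is a bijection onto the simplices of $Y$ of dimension at least $k$. Then \[ J(Y)\le \max\bigl(J(X),\,k+1\bigr). \] -/

import Mathlib

/-- A finite poset `X` with least element `⊥` is *simplicial* if every lower segment
`[⊥, σ] = Set.Iic σ` is isomorphic to the poset of all subsets of a finite set with `n` elements
(that is, to the poset of faces of an `(n - 1)`-simplex, the empty face included). -/
class IsSimplicialPoset (X : Type*) [PartialOrder X] [OrderBot X] : Prop where
  finite : Finite X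
  exists_segment_iso : ∀ σ : X, ∃ n : ℕ, Nonempty (Set.Iic σ ≃o Finset (Fin n))

attribute [instance] IsSimplicialPoset.finite

namespace SimplicialPoset

section Dimension

variable {X : Type*} [PartialOrder X] [OrderBot X] [IsSimplicialPoset X]

/-- The dimension of a simplex `σ`: it is `d` when the segment `[⊥, σ]` is isomorphic to the
subsets of a set with `d + 1` elements. In particular `⊥` has dimension `-1`. -/
noncomputable def dim (σ : X) : ℤ :=
  ((Classical.choose (IsSimplicialPoset.exists_segment_iso σ) : ℕ) : ℤ) - 1

theorem dim_eq_iff (σ : X) (n : ℕ) :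
    dim σ = (n : ℤ) - 1 ↔ Nonempty (Set.Iic σ ≃o Finset (Fin n)) := by
  have hc := Classical.choose_spec (IsSimplicialPoset.exists_segment_iso σ)
  unfold dim
  constructor
  · intro h
    have h' : Classical.choose (IsSimplicialPoset.exists_segment_iso σ) = n := by omega
    rw [h'] at hc
    exact hc
  · rintro ⟨e⟩
    obtain ⟨e'⟩ := hc
    have h := Fintype.card_congr (e'.symm.trans e).toEquiv
    simp only [Fintype.card_finset, Fintype.card_fin] at h
    have := Nat.pow_right_injective (le_refl 2) h
    omega

variable (X) in
/-- The vertices of `X`: its simplices of dimension `0`. -/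
def vertices : Set X := {v | dim v = 0}

/-- The elements of the induced simplicial sub-poset `X[S]`: the simplices of `X` all of whose
vertices are in `S`. -/
def induced (S : Set X) : Set X := {σ | ∀ v ∈ vertices X, v ≤ σ → v ∈ S}

/-- The half-open segment `(σ, ·]` of the induced sub-poset `X[S]`, with the order of `X`. -/
abbrev Above (S : Set X) (σ : X) : Type _ := {τ : X // τ ∈ induced S ∧ σ < τ}

end Dimension

section OrderComplex

variable (P : Type*) [PartialOrder P]

/-- The simplices with `n` vertices (of dimension `n - 1`) of the order complex `Δ(P)`: the totally
ordered subsets of `P` with `n` elements, listed in increasing order. For `n = 0` there is exactly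
one, the empty simplex. -/
abbrev Chain (n : ℕ) : Type _ := Fin n ↪o P

/-- The face of a chain obtained by deleting its `i`-th element. -/
def Chain.face {P : Type*} [PartialOrder P] {n : ℕ} (c : Chain P (n + 1)) (i : Fin (n + 1)) :
    Chain P n :=
  (Fin.succAboveOrderEmb i).trans c

/-- The boundary map, from the rational chains of dimension `n` of `Δ(P)` to those of dimension
`n - 1`, `c ↦ ∑ i, (-1) ^ i • dᵢ c`. For `n = 0` it is the augmentation. -/
noncomputable def boundary (n : ℕ) : (Chain P (n + 1) →₀ ℚ) →ₗ[ℚ] (Chain P n →₀ ℚ) :=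
  Finsupp.lift (Chain P n →₀ ℚ) ℚ (Chain P (n + 1)) fun c =>
    ∑ i : Fin (n + 1), Finsupp.single (c.face i) ((-1 : ℚ) ^ (i : ℕ))

theorem boundary_comp_boundary (n : ℕ) : boundary P n ∘ₗ boundary P (n + 1) = 0 := by
  refine Finsupp.lhom_ext' fun c => LinearMap.ext_ring ?_
  have key : ∀ (m : ℕ) (c : Chain P (m + 1)) (a : ℚ), boundary P m (Finsupp.single c a) =
      ∑ i : Fin (m + 1), Finsupp.single (c.face i) (a * (-1 : ℚ) ^ (i : ℕ)) := by
    intro m c a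
    simp [boundary, Finset.smul_sum]
  simp only [LinearMap.comp_apply, Finsupp.lsingle_apply, LinearMap.zero_apply, key, map_sum,
    one_mul]
  rw [← Finset.sum_product', Finset.univ_product_univ]
  -- the term `(i, j)` with `j < i` cancels against the term `(j, i - 1)`
  have hface : ∀ (i : Fin (n + 2)) (j : Fin (n + 1)),
      ((c.face i).face j) = (c.face (i.succAbove j)).face (j.predAbove i) := by
    intro i j
    apply RelEmbedding.ext
    intro x
    simp only [Chain.face, RelEmbedding.coe_trans, Function.comp_apply,
      Fin.succAboveOrderEmb_apply]
    congr 1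
    exact (Fin.succAbove_succAbove_succAbove_predAbove i j x).symm
  refine Finset.sum_involution (fun p _ => (p.1.succAbove p.2, p.2.predAbove p.1)) ?_ ?_ ?_ ?_
  · rintro ⟨i, j⟩ -
    simp only
    rw [← hface, ← Finsupp.single_add, ← pow_add, ← pow_add]
    have : (-1 : ℚ) ^ ((i : ℕ) + j) +
        (-1 : ℚ) ^ ((i.succAbove j : ℕ) + (j.predAbove i : ℕ)) = 0 := by
      rcases lt_or_ge (j.castSucc) i with h | h
      · rw [Fin.succAbove_of_castSucc_lt _ _ h, Fin.predAbove_of_castSucc_lt _ _ h]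
        have h1 : 0 < (i : ℕ) := lt_of_le_of_lt (Nat.zero_le _) h
        obtain ⟨t, ht⟩ := Nat.exists_eq_succ_of_ne_zero h1.ne'
        simp only [Fin.val_castSucc, Fin.val_pred, ht, Nat.succ_eq_add_one, Nat.add_sub_cancel]
        ring
      · rw [Fin.succAbove_of_le_castSucc _ _ h, Fin.predAbove_of_le_castSucc _ _ h]
        simp only [Fin.val_succ, Fin.coe_castPred]
        ring
    rw [this, Finsupp.single_zero]
  · rintro ⟨i, j⟩ - - h
    exact Fin.succAbove_ne i j (congrArg Prod.fst h)
  · intros; exact Finset.mem_univ _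
  · rintro ⟨i, j⟩ -
    exact Prod.ext (Fin.succAbove_succAbove_predAbove i j) (Fin.predAbove_predAbove_succAbove i j)

/-- The reduced cycles of `Δ(P)` of dimension `n - 1`. -/
noncomputable def reducedCycles : (n : ℕ) → Submodule ℚ (Chain P n →₀ ℚ)
  | 0 => ⊤
  | n + 1 => LinearMap.ker (boundary P n)

/-- The reduced simplicial homology of the order complex `Δ(P)` with rational coefficients, in
dimension `n - 1`. With this convention `Δ(∅)` has reduced homology `ℚ` in dimension `-1`. (The
reduced homology in dimensions below `-1` is zero.) -/
abbrev ReducedHomology (n : ℕ) : Type _ :=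
  reducedCycles P n ⧸ (LinearMap.range (boundary P n)).submoduleOf (reducedCycles P n)

end OrderComplex

section JIndex

variable (X : Type*) [PartialOrder X] [OrderBot X] [IsSimplicialPoset X]

/-- For every `j ≥ l`, every set `S` of vertices of `X` and every simplex `σ` of `X[S]`, the reduced
homology of the order complex of `(σ, ·]` in `X[S]` vanishes in dimension `j`; here `j = n - 1`. -/
def VanishesFrom (l : ℤ) : Prop :=
  ∀ n : ℕ, l ≤ (n : ℤ) - 1 → ∀ S ⊆ vertices X, ∀ σ ∈ induced S,
    Subsingleton (ReducedHomology (Above S σ) n)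

/-- `J(X)`: the smallest integer from which on all these reduced homology groups vanish. -/
noncomputable def J : ℤ := sInf {l : ℤ | VanishesFrom X l}

theorem isLeast_J : IsLeast {l : ℤ | VanishesFrom X l} (J X) := by
  have hne : {l : ℤ | VanishesFrom X l}.Nonempty := by
    refine ⟨(Nat.card X : ℤ), ?_⟩
    intro n hn S _ σ _
    have : IsEmpty (Chain (Above S σ) n) := by
      refine ⟨fun c => ?_⟩
      have h := Nat.card_le_card_of_injective (fun i => (c i : X))
        (Subtype.val_injective.comp c.injective)
      simp only [Nat.card_eq_fintype_card, Fintype.card_fin] at h hn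
      omega
    infer_instance
  have hbdd : BddBelow {l : ℤ | VanishesFrom X l} := by
    refine ⟨0, fun l hl => ?_⟩
    by_contra hlt
    obtain ⟨σ, hσ⟩ := (Set.finite_univ (α := X)).exists_maximal Set.univ_nonempty
    have hl' : l ≤ ((0 : ℕ) : ℤ) - 1 := by push_cast; omega
    have hs := hl 0 hl' (vertices X) subset_rfl σ (fun v hv _ => hv)
    have hP : IsEmpty (Above (vertices X) σ) :=
      ⟨fun τ => (lt_irrefl σ) (τ.2.2.trans_le (hσ.2 (Set.mem_univ τ.1) τ.2.2.le))⟩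
    have hC : IsEmpty (Chain (Above (vertices X) σ) (0 + 1)) := ⟨fun c => hP.false (c 0)⟩
    rw [Submodule.Quotient.subsingleton_iff, Submodule.submoduleOf,
      Submodule.comap_subtype_eq_top] at hs
    let c : Chain (Above (vertices X) σ) 0 := OrderEmbedding.ofIsEmpty
    obtain ⟨y, hy⟩ := hs (show Finsupp.single c (1 : ℚ) ∈ reducedCycles _ 0 from trivial)
    rw [Subsingleton.elim y 0, map_zero] at hy
    exact one_ne_zero (Finsupp.single_eq_zero.mp hy.symm)
  exact ⟨Int.csInf_mem hne hbdd, fun l hl => csInf_le hbdd hl⟩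

end JIndex

end SimplicialPoset

/-! Below a simplex `ρ` of `X` of dimension greater than `k`, all facets have dimension at least
`k`, so `f` is injective on them; this forces `f` to be an isomorphism from `[⊥, ρ]` onto `[⊥, f ρ]`
(`segment_iso_of_injOn`). Let `T` be the set of vertices of `X` sent into `S`, and let `σ'` run over
the preimages of `σ` in `X[T]`. A chain above `σ` in `Y[S]` with top of dimension greater than `k`
lifts to a chain above some `σ'`, and chains with top of dimension at least `k` lift in at most one
way. Hence, for `n > k`, an `n`-cycle above `σ` splits into pushed-forward `n`-cycles above the
various `σ'`; these bound because `n ≥ J(X)`, and so does their sum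
(`subsingleton_reducedHomology_of_family`). -/

namespace SimplicialPoset

/-! ### Chain maps and vanishing of homology. -/

section ChainMaps

variable {P Q : Type*} [PartialOrder P] [PartialOrder Q]

/-- The image of a chain under a strictly monotone map. -/
def Chain.map {n : ℕ} (φ : Q → P) (hφ : StrictMono φ) (c : Chain Q n) : Chain P n :=
  OrderEmbedding.ofStrictMono (φ ∘ c) (hφ.comp c.strictMono)

@[simp]
theorem Chain.map_apply {n : ℕ} (φ : Q → P) (hφ : StrictMono φ) (c : Chain Q n) (i : Fin n) :
    c.map φ hφ i = φ (c i) := rfl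

/-- The linear map on rational chains induced by a strictly monotone map. -/
noncomputable def chainMap (φ : Q → P) (hφ : StrictMono φ) (n : ℕ) :
    (Chain Q n →₀ ℚ) →ₗ[ℚ] (Chain P n →₀ ℚ) :=
  Finsupp.lmapDomain ℚ ℚ (Chain.map φ hφ)

theorem boundary_single (n : ℕ) (c : Chain P (n + 1)) (a : ℚ) :
    boundary P n (Finsupp.single c a) =
      ∑ i : Fin (n + 1), Finsupp.single (c.face i) (a * (-1 : ℚ) ^ (i : ℕ)) := by
  simp [boundary, Finset.smul_sum]

theorem boundary_chainMap (φ : Q → P) (hφ : StrictMono φ) (n : ℕ) (z : Chain Q (n + 1) →₀ ℚ) :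
    boundary P n (chainMap φ hφ (n + 1) z) = chainMap φ hφ n (boundary Q n z) := by
  induction z using Finsupp.induction_linear with
  | zero => simp
  | add x y hx hy => simp only [map_add, hx, hy]
  | single c a =>
    simp only [chainMap, Finsupp.lmapDomain_apply, Finsupp.mapDomain_single, boundary_single]
    rw [Finsupp.mapDomain_finsetSum]
    refine Finset.sum_congr rfl fun i _ => ?_
    rw [Finsupp.mapDomain_single]
    rfl

theorem subsingleton_reducedHomology_succ_iff (n : ℕ) :
    Subsingleton (ReducedHomology P (n + 1)) ↔
      ∀ z, boundary P n z = 0 → ∃ w, boundary P (n + 1) w = z := by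
  rw [Submodule.Quotient.subsingleton_iff, Submodule.submoduleOf,
    Submodule.comap_subtype_eq_top]
  rfl

/-- Vanishing of homology passes to a subposet containing all chains of the next dimension. -/
theorem subsingleton_reducedHomology_of_embedding (φ : Q → P) (hφ : StrictMono φ)
    (hinj : Function.Injective φ) (n : ℕ)
    (hsurj : Function.Surjective (Chain.map (n := n + 2) φ hφ))
    (hP : Subsingleton (ReducedHomology P (n + 1))) :
    Subsingleton (ReducedHomology Q (n + 1)) := by
  rw [subsingleton_reducedHomology_succ_iff] at hP ⊢
  intro z hz
  obtain ⟨w, hw⟩ := hP (chainMap φ hφ (n + 1) z) (by rw [boundary_chainMap, hz, map_zero])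
  obtain ⟨w', rfl⟩ := Finsupp.mapDomain_surjective hsurj w
  refine ⟨w', ?_⟩
  have hc : Function.Injective (Chain.map (n := n + 1) φ hφ) := fun c c' h =>
    RelEmbedding.ext fun i => hinj (DFunLike.congr_fun h i)
  refine Finsupp.mapDomain_injective hc ?_
  exact (boundary_chainMap φ hφ (n + 1) w').symm.trans hw

/-- Vanishing of homology passes along a family of strictly monotone maps which is jointly
surjective on chains of one dimension and jointly injective on chains one dimension lower. -/
theorem subsingleton_reducedHomology_of_family {ι : Type*} [Finite ι] {R : ι → Type*}
    [∀ i, PartialOrder (R i)] (φ : ∀ i, R i → P) (hφ : ∀ i, StrictMono (φ i)) (n : ℕ)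
    (hsurj : ∀ c : Chain P (n + 1), ∃ i, ∃ c' : Chain (R i) (n + 1), c'.map (φ i) (hφ i) = c)
    (hinj : Function.Injective
      fun p : (Σ i, Chain (R i) n) => p.2.map (φ p.1) (hφ p.1))
    (hR : ∀ i, Subsingleton (ReducedHomology (R i) (n + 1))) :
    Subsingleton (ReducedHomology P (n + 1)) := by
  classical
  have := Fintype.ofFinite ι
  simp only [subsingleton_reducedHomology_succ_iff] at hR ⊢
  intro z hz
  have hdec : ∀ z : Chain P (n + 1) →₀ ℚ, ∃ u : ∀ i, Chain (R i) (n + 1) →₀ ℚ,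
      ∑ i, chainMap (φ i) (hφ i) (n + 1) (u i) = z := by
    intro z
    induction z using Finsupp.induction_linear with
    | zero => exact ⟨0, by simp⟩
    | add x y hx hy =>
      obtain ⟨u, rfl⟩ := hx
      obtain ⟨v, rfl⟩ := hy
      exact ⟨u + v, by simp [Finset.sum_add_distrib]⟩
    | single c a =>
      obtain ⟨i, c', rfl⟩ := hsurj c
      refine ⟨Pi.single i (Finsupp.single c' a), ?_⟩
      rw [Finset.sum_eq_single i]
      · simp [chainMap, Finsupp.mapDomain_single]
      · intro j _ hj
        rw [Pi.single_eq_of_ne hj, map_zero]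
      · simp
  obtain ⟨u, rfl⟩ := hdec z
  -- By joint injectivity, the coefficient of the total boundary at the image of `c` comes from the
  -- `i`-th summand alone.
  have hu : ∀ i, boundary (R i) n (u i) = 0 := by
    intro i
    ext c
    have h := DFunLike.congr_fun hz (c.map (φ i) (hφ i))
    simp only [map_sum, boundary_chainMap, Finsupp.finsetSum_apply, Finsupp.zero_apply] at h
    rw [Finset.sum_eq_single i] at h
    · have hi : Function.Injective (Chain.map (n := n) (φ i) (hφ i)) := fun c c' hcc =>
        eq_of_heq (Sigma.mk.inj (hinj (a₁ := ⟨i, c⟩) (a₂ := ⟨i, c'⟩) hcc)).2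
      exact (Finsupp.mapDomain_apply hi _ _).symm.trans h
    · intro j _ hj
      refine Finsupp.mapDomain_of_notMem_range _ _ ?_
      rintro ⟨c', hc'⟩
      exact hj (congrArg Sigma.fst (hinj (a₁ := ⟨j, c'⟩) (a₂ := ⟨i, c⟩) hc'))
    · simp
  choose w hw using fun i => hR i (u i) (hu i)
  refine ⟨∑ i, chainMap (φ i) (hφ i) (n + 2) (w i), ?_⟩
  simp only [map_sum, boundary_chainMap, hw]

end ChainMaps

/-! ### Rigidity of Boolean lattices and segments. -/

/-- A monotone cardinality-preserving self-map of a Boolean lattice which is injective on coatoms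
is induced by a permutation of the atoms. -/
theorem exists_perm_of_monotone_of_card {N : ℕ} (g : Finset (Fin N) → Finset (Fin N))
    (hg : Monotone g) (hcard : ∀ s, (g s).card = s.card)
    (hinj : Set.InjOn g {s | s.card + 1 = N}) :
    ∃ π : Equiv.Perm (Fin N), ∀ s, g s = s.map π.toEmbedding := by
  classical
  have hco : ∀ a : Fin N, (({a}ᶜ : Finset (Fin N))).card + 1 = N := by
    intro a
    have := Finset.card_add_card_compl ({a} : Finset (Fin N))
    simp only [Finset.card_singleton, Fintype.card_fin] at this
    omega
  have hp : ∀ a : Fin N, ∃ b : Fin N, (g {a}ᶜ)ᶜ = {b} := by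
    intro a
    rw [← Finset.card_eq_one]
    have h1 := Finset.card_add_card_compl (g {a}ᶜ)
    have h2 := hco a
    rw [hcard, Fintype.card_fin] at h1
    omega
  -- The coatom omitting `a` goes to the coatom omitting `p a`. If `a ∉ s`, then `g s` omits `p a`;
  -- so `g s` lies in the image of `s` under `p`, and cardinalities give equality.
  choose p hp using hp
  have hpinj : Function.Injective p := by
    intro a b hab
    have h : g {a}ᶜ = g {b}ᶜ := compl_injective (by rw [hp, hp, hab])
    exact Finset.singleton_injective (compl_injective (hinj (hco a) (hco b) h))
  refine ⟨Equiv.ofBijective p (Finite.injective_iff_bijective.mp hpinj), fun s => ?_⟩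
  refine Finset.eq_of_subset_of_card_le (fun y hy => ?_) (by simp [hcard])
  obtain ⟨a, rfl⟩ := (Finite.injective_iff_surjective.mp hpinj) y
  have ha : a ∈ s := by
    by_contra ha
    have h1 : g s ≤ g {a}ᶜ := hg (by
      intro x hx
      simp only [Finset.mem_compl, Finset.mem_singleton]
      rintro rfl
      exact ha hx)
    have h2 : p a ∈ (g {a}ᶜ)ᶜ := by rw [hp]; simp
    exact (Finset.mem_compl.mp h2) (h1 hy)
  exact Finset.mem_map.mpr ⟨a, ha, rfl⟩

section Segments

variable {X : Type*} [PartialOrder X] [OrderBot X] [IsSimplicialPoset X]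

theorem neg_one_le_dim (σ : X) : -1 ≤ dim σ := by
  unfold dim
  omega

/-- An isomorphism from a segment to a Boolean lattice computes dimensions by cardinalities. -/
theorem dim_eq_card_sub_one {ρ : X} {N : ℕ} (e : Set.Iic ρ ≃o Finset (Fin N)) (x : Set.Iic ρ) :
    dim (x : X) = ((e x).card : ℤ) - 1 := by
  rw [dim_eq_iff]
  let e₁ : Set.Iic (x : X) ≃o Set.Iic x :=
    { toFun := fun y => ⟨⟨y, le_trans y.2 x.2⟩, y.2⟩
      invFun := fun y => ⟨y.1, y.2⟩
      left_inv := fun _ => rfl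
      right_inv := fun _ => rfl
      map_rel_iff' := Iff.rfl }
  let e₂ : Set.Iic x ≃o Set.Iic (e x) :=
    { toFun := fun y => ⟨e y, e.monotone y.2⟩
      invFun := fun s => ⟨e.symm s, e.symm_apply_le.mpr s.2⟩
      left_inv := fun y => Subtype.ext (e.symm_apply_apply _)
      right_inv := fun s => Subtype.ext (e.apply_symm_apply _)
      map_rel_iff' := e.le_iff_le }
  let j : Fin (e x).card ↪o Fin N := (e x).orderEmbOfFin rfl
  have hj : ∀ s : Finset (Fin (e x).card), s.map j.toEmbedding ≤ e x := by
    intro s a ha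
    obtain ⟨b, -, rfl⟩ := Finset.mem_map.mp ha
    exact Finset.orderEmbOfFin_mem _ _ _
  let e₃ : Finset (Fin (e x).card) ≃o Set.Iic (e x) :=
    RelIso.ofSurjective
      (⟨⟨fun s => ⟨s.map j.toEmbedding, hj s⟩, fun s t h =>
        Finset.map_injective _ (congrArg Subtype.val h)⟩, Finset.map_subset_map⟩ :
        Finset (Fin (e x).card) ↪o Set.Iic (e x))
      (by
        rintro ⟨s, hs⟩
        refine ⟨Finset.univ.filter fun b => j b ∈ s, Subtype.ext (Finset.ext fun a => ?_)⟩
        change a ∈ Finset.map _ _ ↔ a ∈ s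
        constructor
        · intro ha
          obtain ⟨b, hb, rfl⟩ := Finset.mem_map.mp ha
          exact (Finset.mem_filter.mp hb).2
        · intro ha
          have hr : a ∈ Set.range ((e x).orderEmbOfFin rfl) := by
            rw [Finset.range_orderEmbOfFin]
            exact hs ha
          obtain ⟨b, rfl⟩ := hr
          exact Finset.mem_map.mpr ⟨b, Finset.mem_filter.mpr ⟨Finset.mem_univ _, ha⟩, rfl⟩)
  exact ⟨(e₁.trans e₂).trans e₃.symm⟩

theorem dim_strictMono : StrictMono (dim : X → ℤ) := by
  intro σ τ h
  obtain ⟨N, ⟨e⟩⟩ := IsSimplicialPoset.exists_segment_iso τ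
  have h1 := dim_eq_card_sub_one e ⟨σ, h.le⟩
  have h2 := dim_eq_card_sub_one e ⟨τ, le_rfl⟩
  have h3 : e ⟨σ, h.le⟩ < e ⟨τ, le_rfl⟩ := e.strictMono h
  have h4 := Finset.card_lt_card h3
  simp only at h1 h2
  omega

/-- A chain of simplices strictly above `σ` has dimension growing with its length. -/
theorem dim_add_le_dim_chain {σ : X} {n : ℕ} (c : Fin n → X) (hc : StrictMono c)
    (h : ∀ i, σ < c i) (i : Fin n) : dim σ + (i : ℕ) + 1 ≤ dim (c i) := by
  obtain ⟨i, hi⟩ := i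
  induction i with
  | zero =>
    have := dim_strictMono (h ⟨0, hi⟩)
    simp only
    omega
  | succ i ih =>
    have h1 := ih (by omega)
    have h2 := dim_strictMono (hc (show (⟨i, by omega⟩ : Fin n) < ⟨i + 1, hi⟩ by simp))
    simp only at h1 ⊢
    push_cast
    omega

theorem mem_induced_of_le {S : Set X} {σ τ : X} (h : σ ≤ τ) (hτ : τ ∈ induced S) :
    σ ∈ induced S := fun v hv hvσ => hτ v hv (hvσ.trans h)

end Segments

/-! ### Lifting chains along the map. -/

section DimensionPreserving

variable {X Y : Type*} [PartialOrder X] [OrderBot X] [IsSimplicialPoset X]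
  [PartialOrder Y] [OrderBot Y] [IsSimplicialPoset Y] {f : X → Y}

theorem strictMono_of_dim_eq (hf : Monotone f) (hd : ∀ σ, dim (f σ) = dim σ) : StrictMono f := by
  intro σ τ h
  refine lt_of_le_of_ne (hf h.le) fun he => ?_
  have := dim_strictMono h
  rw [← hd σ, ← hd τ, he] at this
  exact lt_irrefl _ this

/-- A monotone dimension-preserving map which is injective on the facets of `ρ` restricts to an
isomorphism of the segment below `ρ` onto the segment below `f ρ`. -/
theorem segment_iso_of_injOn (hf : Monotone f) (hd : ∀ σ, dim (f σ) = dim σ) (ρ : X)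
    (hinj : Set.InjOn f {σ | dim σ + 1 = dim ρ}) :
    (∀ σ ≤ ρ, ∀ τ ≤ ρ, (f σ ≤ f τ ↔ σ ≤ τ)) ∧ ∀ y ≤ f ρ, ∃ x ≤ ρ, f x = y := by
  obtain ⟨N, ⟨e⟩⟩ := IsSimplicialPoset.exists_segment_iso ρ
  have hN : dim ρ = (N : ℤ) - 1 := (dim_eq_iff ρ N).mpr ⟨e⟩
  obtain ⟨e'⟩ := (dim_eq_iff (f ρ) N).mp ((hd ρ).trans hN)
  let g₀ : Set.Iic ρ → Set.Iic (f ρ) := fun x => ⟨f x, hf x.2⟩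
  -- Both segments have the same rank `N`, so `f` becomes a self-map of one Boolean lattice.
  let g : Finset (Fin N) → Finset (Fin N) := fun s => e' (g₀ (e.symm s))
  have hcard : ∀ s, (g s).card = s.card := by
    intro s
    have h1 := dim_eq_card_sub_one e' (g₀ (e.symm s))
    have h2 := dim_eq_card_sub_one e (e.symm s)
    have h3 : dim ((g₀ (e.symm s) : Set.Iic (f ρ)) : Y) = dim ((e.symm s : Set.Iic ρ) : X) :=
      hd _
    rw [OrderIso.apply_symm_apply] at h2
    change _ = ((g s).card : ℤ) - 1 at h1
    omega
  have hdim : ∀ s : Finset (Fin N), s.card + 1 = N →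
      dim ((e.symm s : Set.Iic ρ) : X) + 1 = dim ρ := by
    intro s hs
    have h2 := dim_eq_card_sub_one e (e.symm s)
    rw [OrderIso.apply_symm_apply] at h2
    omega
  obtain ⟨π, hπ⟩ := exists_perm_of_monotone_of_card g
    (fun s t h => e'.monotone (hf (e.symm.monotone h))) hcard (by
      intro s hs t ht hst
      have h1 : f (e.symm s) = f (e.symm t) := congrArg Subtype.val (e'.injective hst)
      exact e.symm.injective (Subtype.ext (hinj (hdim s hs) (hdim t ht) h1)))
  have hg : ∀ x : Set.Iic ρ, e' (g₀ x) = (e x).map π.toEmbedding := by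
    intro x
    rw [← hπ, show g (e x) = e' (g₀ (e.symm (e x))) from rfl, OrderIso.symm_apply_apply]
  constructor
  · intro σ hσ τ hτ
    change g₀ ⟨σ, hσ⟩ ≤ g₀ ⟨τ, hτ⟩ ↔ (⟨σ, hσ⟩ : Set.Iic ρ) ≤ ⟨τ, hτ⟩
    rw [← e'.le_iff_le, hg, hg, ← e.le_iff_le]
    exact Finset.map_subset_map
  · intro y hy
    let x := e.symm ((e' ⟨y, hy⟩).map π.symm.toEmbedding)
    refine ⟨x, x.2, ?_⟩
    have h : g₀ x = ⟨y, hy⟩ := by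
      apply e'.injective
      rw [hg, OrderIso.apply_symm_apply, Finset.map_map]
      convert Finset.map_refl
      ext a
      simp
    exact congrArg Subtype.val h

variable (X) in
/-- The faces of the simplices of dimension greater than `k`. -/
def facesAbove (k : ℕ) : Set X := {σ | ∃ ρ, σ ≤ ρ ∧ (k : ℤ) + 1 ≤ dim ρ}

theorem dim_add_le_dim_chain_above {S : Set X} {σ : X} {n : ℕ} (c : Chain (Above S σ) n)
    (i : Fin n) : (i : ℤ) ≤ dim (c i : X) := by
  have h := dim_add_le_dim_chain (fun i => (c i : X)) (fun _ _ h => c.strictMono h)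
    (fun i => (c i).2.2) i
  have := neg_one_le_dim σ
  omega

/-- The restriction of `f` to the faces of a simplex of dimension greater than `k`. -/
theorem segment_iso_of_mem_facesAbove (hf : Monotone f) (hd : ∀ σ, dim (f σ) = dim σ) {k : ℕ}
    (hinj : Set.InjOn f {σ : X | (k : ℤ) ≤ dim σ}) {ρ : X} (hρ : ρ ∈ facesAbove X k) :
    (∀ σ ≤ ρ, ∀ τ ≤ ρ, (f σ ≤ f τ ↔ σ ≤ τ)) ∧ ∀ y ≤ f ρ, ∃ x ≤ ρ, f x = y := by
  obtain ⟨ρ', hle, hρ'⟩ := hρ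
  obtain ⟨h1, h2⟩ := segment_iso_of_injOn hf hd ρ' (hinj.mono fun σ hσ => by
    simp only [Set.mem_ofPred_eq] at hσ ⊢
    omega)
  refine ⟨fun σ hσ τ hτ => h1 σ (hσ.trans hle) τ (hτ.trans hle), fun y hy => ?_⟩
  obtain ⟨x, hx, rfl⟩ := h2 y (hy.trans (hf hle))
  exact ⟨x, (h1 x hx ρ hle).mp hy, rfl⟩

/-- The part of `Above S σ` formed by the faces of simplices of dimension greater than `k`. -/
abbrev AboveFaces (k : ℕ) (S : Set X) (σ : X) : Type _ :=
  {τ : Above S σ // (τ : X) ∈ facesAbove X k}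

/-- A chain of `n + 2` simplices above `σ` has top of dimension at least `n + 1 > k`, so discarding
the other simplices loses no chain of that length. -/
theorem subsingleton_reducedHomology_aboveFaces {k n : ℕ} (hn : k ≤ n) {S : Set X} {σ : X}
    (h : Subsingleton (ReducedHomology (Above S σ) (n + 1))) :
    Subsingleton (ReducedHomology (AboveFaces k S σ) (n + 1)) := by
  refine subsingleton_reducedHomology_of_embedding (fun τ : AboveFaces k S σ => τ.1)
    (fun _ _ h => h) Subtype.val_injective n (fun c => ?_) h
  have hc : ∀ i, (c i : X) ∈ facesAbove X k := by
    intro i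
    refine ⟨c (Fin.last (n + 1)), c.monotone (Fin.le_last i), ?_⟩
    have := dim_add_le_dim_chain_above c (Fin.last (n + 1))
    simp only [Fin.val_last] at this
    omega
  refine ⟨OrderEmbedding.ofStrictMono (fun i => ⟨c i, hc i⟩) fun _ _ h => c.strictMono h, ?_⟩
  exact RelEmbedding.ext fun _ => rfl

theorem subsingleton_reducedHomology_above {k n : ℕ} (hn : k < n) (hf : Monotone f)
    (hd : ∀ σ, dim (f σ) = dim σ)
    (hb : Set.BijOn f {σ : X | (k : ℤ) ≤ dim σ} {τ : Y | (k : ℤ) ≤ dim τ})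
    (S : Set Y) (σ : Y)
    (h : ∀ σ' ∈ induced {v ∈ vertices X | f v ∈ S},
      Subsingleton (ReducedHomology (Above {v ∈ vertices X | f v ∈ S} σ') (n + 1))) :
    Subsingleton (ReducedHomology (Above S σ) (n + 1)) := by
  have hs := strictMono_of_dim_eq hf hd
  set T : Set X := {v ∈ vertices X | f v ∈ S}
  have hind : ∀ τ : X, f τ ∈ induced S → τ ∈ induced T := fun τ hτ v hv hvτ =>
    ⟨hv, hτ (f v) ((hd v).trans hv) (hf hvτ)⟩
  -- Membership in `facesAbove` ensures that every vertex of `f τ` is the image of a vertex of `τ`.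
  have hind' : ∀ τ ∈ facesAbove X k, τ ∈ induced T → f τ ∈ induced S := by
    intro τ hτ hτT y hy hyτ
    obtain ⟨v, hv, rfl⟩ := (segment_iso_of_mem_facesAbove hf hd hb.injOn hτ).2 y hyτ
    exact (hτT v ((hd v).symm.trans hy) hv).2
  let ι : Type _ := {σ' : X // f σ' = σ ∧ σ' ∈ induced T}
  let φ : ∀ i : ι, AboveFaces k T i.1 → Above S σ := fun i τ =>
    ⟨f τ.1, hind' _ τ.2 τ.1.2.1, i.2.1.symm.trans_lt (hs τ.1.2.2)⟩
  have hφ : ∀ i, StrictMono (φ i) := fun i _ _ h => hs h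
  refine subsingleton_reducedHomology_of_family φ hφ n ?_ ?_
    fun i => subsingleton_reducedHomology_aboveFaces (by omega) (h i.1 i.2.2)
  -- Surjectivity on chains of `n + 1` elements: the top has dimension at least `n ≥ k + 1`, so it
  -- lifts to `t`, and the segment isomorphism below `t` lifts `σ` and the rest.
  · intro c
    have htop : (k : ℤ) + 1 ≤ dim (c (Fin.last n) : Y) := by
      have := dim_add_le_dim_chain_above c (Fin.last n)
      simp only [Fin.val_last] at this
      omega
    obtain ⟨t, -, ht⟩ := hb.surjOn (show (c (Fin.last n) : Y) ∈ {τ : Y | (k : ℤ) ≤ dim τ} by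
      simp only [Set.mem_ofPred_eq]; omega)
    have htk : (k : ℤ) + 1 ≤ dim t := by rw [← hd, ht]; exact htop
    obtain ⟨hle, hex⟩ := segment_iso_of_mem_facesAbove hf hd hb.injOn
      (show t ∈ facesAbove X k from ⟨t, le_rfl, htk⟩)
    have hlt : ∀ σ ≤ t, ∀ τ ≤ t, f σ < f τ → σ < τ := fun σ hσ τ hτ h =>
      lt_of_le_not_ge ((hle σ hσ τ hτ).mp h.le) fun h' => h.not_ge (hf h')
    have hct : ∀ i, (c i : Y) ≤ f t := fun i => ht ▸ c.monotone (Fin.le_last i)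
    choose x hxt hx using fun i => hex (c i) (hct i)
    obtain ⟨s, hst, rfl⟩ := hex σ ((c (Fin.last n)).2.2.le.trans (hct _))
    have hsx : ∀ i, s < x i := fun i =>
      hlt s hst (x i) (hxt i) (by rw [hx i]; exact (c i).2.2)
    have hxT : ∀ i, x i ∈ induced T := fun i => hind _ (by rw [hx i]; exact (c i).2.1)
    refine ⟨⟨s, rfl, mem_induced_of_le (hsx 0).le (hxT 0)⟩, OrderEmbedding.ofStrictMono
      (fun i => ⟨⟨x i, hxT i, hsx i⟩, t, hxt i, htk⟩) fun i j hij => ?_, ?_⟩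
    · refine hlt (x i) (hxt i) (x j) (hxt j) ?_
      rw [hx i, hx j]
      exact c.strictMono hij
    · exact RelEmbedding.ext fun i => Subtype.ext (hx i)
  -- Injectivity on chains of `n` elements: the top has dimension at least `n - 1 ≥ k`, so it is
  -- determined by its image. It is also a face of a simplex of dimension greater than `k`, so `f`
  -- is injective below it.
  · rintro ⟨⟨s, hs₁, hs₂⟩, c⟩ ⟨⟨s', hs₁', hs₂'⟩, c'⟩ hcc
    obtain ⟨m, rfl⟩ : ∃ m, n = m + 1 := ⟨n - 1, by omega⟩
    have hval : ∀ i, f (c i).1 = f (c' i).1 := fun i =>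
      congrArg Subtype.val (DFunLike.congr_fun hcc i)
    have hdim : (k : ℤ) ≤ dim ((c (Fin.last m)).1 : X) := by
      have : ((Fin.last m : ℕ) : ℤ) ≤ dim ((c (Fin.last m)).1 : X) := dim_add_le_dim_chain_above
        (c.map (fun τ : AboveFaces k T s => τ.1) fun _ _ h => h) (Fin.last m)
      simp only [Fin.val_last] at this
      omega
    have htop : ((c (Fin.last m)).1 : X) = (c' (Fin.last m)).1 := by
      refine hb.injOn hdim ?_ (hval _)
      simp only [Set.mem_ofPred_eq]
      rw [← hd, ← hval, hd]
      exact hdim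
    have hle := (segment_iso_of_mem_facesAbove hf hd hb.injOn (c (Fin.last m)).2).1
    have heq : ∀ a ≤ ((c (Fin.last m)).1 : X), ∀ b ≤ ((c (Fin.last m)).1 : X),
        f a = f b → a = b := fun a ha b hb' hab =>
      le_antisymm ((hle a ha b hb').mp hab.le) ((hle b hb' a ha).mp hab.ge)
    obtain rfl : s = s' := heq s (c (Fin.last m)).1.2.2.le s'
      (by rw [htop]; exact (c' (Fin.last m)).1.2.2.le) (hs₁.trans hs₁'.symm)
    obtain rfl : c = c' := RelEmbedding.ext fun i => Subtype.ext (Subtype.ext (heq _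
      (c.monotone (Fin.le_last i)) _ (by rw [htop]; exact c'.monotone (Fin.le_last i)) (hval i)))
    rfl

end DimensionPreserving

end SimplicialPoset

theorem mainTheorem7 {X Y : Type*}
    [PartialOrder X] [OrderBot X] [IsSimplicialPoset X]
    [PartialOrder Y] [OrderBot Y] [IsSimplicialPoset Y]
    (k : ℕ) (f : X → Y)
    (hf_mono : Monotone f)
    (hf_dim : ∀ σ : X, SimplicialPoset.dim (f σ) = SimplicialPoset.dim σ)
    (hf_bij : Set.BijOn f {σ : X | (k : ℤ) ≤ SimplicialPoset.dim σ}
      {τ : Y | (k : ℤ) ≤ SimplicialPoset.dim τ}) :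
    SimplicialPoset.J Y ≤ max (SimplicialPoset.J X) ((k : ℤ) + 1) := by
  refine (SimplicialPoset.isLeast_J Y).2 fun n hn S _ σ _ => ?_
  obtain ⟨hJ, hk⟩ := max_le_iff.mp hn
  obtain ⟨m, rfl⟩ : ∃ m, n = m + 1 := ⟨n - 1, by omega⟩
  exact SimplicialPoset.subsingleton_reducedHomology_above (by omega) hf_mono hf_dim hf_bij S σ
    fun σ' hσ' => (SimplicialPoset.isLeast_J X).1 (m + 1) hJ _ (fun _ hv => hv.1) σ' hσ'
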